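/- Let $d\ge 1$, $n\ge 2$, $0<\eta<1$, and let $\mathcal S$ be an $\eta$-sparse family of dyadic cubes $2^{-k}(m+[0,1)^d)$ ($k\in\mathbb Z$, $m\in\mathbb Z^d$) in $\mathbb R^d$: for each $S\in\mathcal S$ there is a measurable set $E(S)\subset S$ with $|E(S)|\ge\eta|S|$, and the sets $E(S)$, $S\in\mathcal S$, are pairwise disjoint. Let $1<p_1,\dots,p_n<\infty$, $p_i'=p_i/(p_i-1)$, and let $K(S)=\ell_S^{\alpha-(n-1)d}$ with $0<\alpha<(n-1)d$, where $\ell_S$ is the side length of $S$. For a weight $\sigma$ write $\sigma(S)=\int_S\sigma\,dx$. (a) Suppose $\sum_{i=1}^n 1/p_i\ge 1$ and let $\sigma_i(x)=|x|^{\beta_i}$ with $\beta_i>-d$, $i=1,\dots,n$. If $$\alpha+d\Bigl(1-\sum_{i=1}^n\frac1{p_i}\Bigr)+\sum_{i=1}^n\frac{\beta_i}{p_i'}=0\qquad\text{and}\qquad \sum_{i=1}^n\frac{\beta_i}{p_i'}\le 0,$$ then $$A_0=\sup_{S\in\mathcal S}K(S)\,|S|^{\,n-\sum_i 1/p_i}\prod_{i=1}^n\left(\frac{\sigma_i(S)}{|S|}\right)^{1/p_i'}<\infty.$$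 (b) Suppose $\sum_{i=1}^n 1/p_i<1$, define $r$ by $1/r+\sum_{i=1}^n 1/p_i=1$, and let $\sigma_i(x)=|x|^{\beta_i}\max(|x|,1)^{p_i'\rho/n}$ with $\rho<-d/r$ and $\beta_i+p_i'\rho/n>-d$, $i=1,\dots,n$. If $\alpha+\sum_{i=1}^n\beta_i/p_i'=0$, then $$A_0=\Bigl[\sum_{S\in\mathcal S}\Bigl(K(S)\,|S|^{n-1}\prod_{i=1}^n\Bigl(\frac{\sigma_i(S)}{|S|}\Bigr)^{1/p_i'}\Bigr)^r|E(S)|\Bigr]^{1/r}<\infty.$$ -/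

import Mathlib

open MeasureTheory
open scoped ENNReal

/-- The (index of a) half-open dyadic cube `2 ^ (-k) * (m + [0,1)^d)` in `ℝ^d`.
For `d ≥ 1` distinct indices give distinct cubes. -/
structure DyadicCube (d : ℕ) where
  k : ℤ
  m : Fin d → ℤ

namespace DyadicCube

variable {d : ℕ}

/-- The side length `2 ^ (-k)`. -/
noncomputable def sideLength (Q : DyadicCube d) : ℝ := (2 : ℝ) ^ (-Q.k)

/-- The cube as a set of points. -/
def carrier (Q : DyadicCube d) : Set (EuclideanSpace ℝ (Fin d)) :=
  {x | ∀ j, x j ∈ Set.Ico (Q.sideLength * (Q.m j : ℝ)) (Q.sideLength * ((Q.m j : ℝ) + 1))}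

end DyadicCube

/-- The family `S` of dyadic cubes is `η`-sparse, and this is witnessed by the measurable,
pairwise disjoint major subsets `E Q ⊆ Q`, `Q ∈ S`. -/
structure IsSparseWith {d : ℕ} (η : ℝ) (S : Set (DyadicCube d))
    (E : DyadicCube d → Set (EuclideanSpace ℝ (Fin d))) : Prop where
  measurableSet : ∀ Q ∈ S, MeasurableSet (E Q)
  subset : ∀ Q ∈ S, E Q ⊆ Q.carrier
  le_volume : ∀ Q ∈ S, ENNReal.ofReal η * volume Q.carrier ≤ volume (E Q)
  pairwiseDisjoint : S.PairwiseDisjoint E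

/-- `σ(A) = ∫_A σ dx` for a nonnegative function `σ`. -/
noncomputable def weightMass {d : ℕ} (σ : EuclideanSpace ℝ (Fin d) → ℝ)
    (A : Set (EuclideanSpace ℝ (Fin d))) : ℝ≥0∞ :=
  ∫⁻ x in A, ENNReal.ofReal (σ x)

/-- `∏ i, (σ_i(Q) / |Q|) ^ (1 / p_i')`, with `p_i' = p_i / (p_i - 1)`. -/
noncomputable def avgProduct {d n : ℕ} (σ : Fin n → EuclideanSpace ℝ (Fin d) → ℝ)
    (p : Fin n → ℝ) (Q : DyadicCube d) : ℝ≥0∞ :=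
  ∏ i, (weightMass (σ i) Q.carrier / volume Q.carrier) ^ (1 / (p i).conjExponent)

/-- The constant
`sup_{Q ∈ S} K(Q) |Q| ^ (n - ∑ 1/p_i) ∏ i, (σ_i(Q) / |Q|) ^ (1/p_i')`. -/
noncomputable def supConstant {d n : ℕ} (K : DyadicCube d → ℝ) (S : Set (DyadicCube d))
    (σ : Fin n → EuclideanSpace ℝ (Fin d) → ℝ) (p : Fin n → ℝ) : ℝ≥0∞ :=
  ⨆ Q ∈ S, ENNReal.ofReal (K Q) * volume Q.carrier ^ ((n : ℝ) - ∑ i, 1 / p i) * avgProduct σ p Q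

/-- The constant
`[∑_{Q ∈ S} (K(Q) |Q| ^ (n - 1) ∏ i, (σ_i(Q) / |Q|) ^ (1/p_i')) ^ r |E(Q)|] ^ (1/r)`. -/
noncomputable def sumConstant {d n : ℕ} (K : DyadicCube d → ℝ) (S : Set (DyadicCube d))
    (E : DyadicCube d → Set (EuclideanSpace ℝ (Fin d)))
    (σ : Fin n → EuclideanSpace ℝ (Fin d) → ℝ) (p : Fin n → ℝ) (r : ℝ) : ℝ≥0∞ :=
  (∑' Q : S, (ENNReal.ofReal (K Q) * volume (Q : DyadicCube d).carrier ^ ((n : ℝ) - 1)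
    * avgProduct σ p Q) ^ r * volume (E Q)) ^ (1 / r)

/-- The kernel `K(Q) = ℓ_Q ^ (α - (n - 1) d)` of the sparse Riesz potential. -/
noncomputable def rieszKernel (d n : ℕ) (α : ℝ) (Q : DyadicCube d) : ℝ :=
  Q.sideLength ^ (α - ((n : ℝ) - 1) * d)

/-- The power weight `|x| ^ β`. -/
noncomputable def powerWeight {d : ℕ} (β : ℝ) (x : EuclideanSpace ℝ (Fin d)) : ℝ :=
  ‖x‖ ^ β

/-- The weight `|x| ^ β * max(|x|, 1) ^ γ`. -/
noncomputable def dampedPowerWeight {d : ℕ} (β γ : ℝ) (x : EuclideanSpace ℝ (Fin d)) : ℝ :=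
  ‖x‖ ^ β * max ‖x‖ 1 ^ γ

/-! Every estimate is in terms of two lengths of a cube `Q`: its side `ℓ` and its radius `R`,
comparable to `ℓ` plus the distance to the origin, so `ℓ ≤ R`. Local integrability makes the average
of `|x| ^ β` over `Q` at most a constant times `R ^ β` (`weightMass_powerWeight_le`), and similarly
for damped weights. By the balance condition the powers of `ℓ` and `R` combine into `(ℓ / R) ^ a`
with `a ≥ 0`, which is at most 1. In (a) nothing else remains, so the supremum is finite. In (b) the
damping leaves `max R 1 ^ ρ`. Since `|x| ≤ R` on `Q` and the sets `E Q` are disjoint, the sum of its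
`r`-th powers is dominated by the integral of `max |x| 1 ^ (ρ r)`, which converges because `ρ r <
-d`. -/

namespace DyadicCube

variable {d : ℕ}

/-! ### Geometry of dyadic cubes -/

lemma sideLength_pos (Q : DyadicCube d) : 0 < Q.sideLength := zpow_pos (by norm_num) _

/-- The corner of the cube with the smallest coordinates. -/
noncomputable def corner (Q : DyadicCube d) : EuclideanSpace ℝ (Fin d) :=
  WithLp.toLp 2 fun j => Q.sideLength * (Q.m j : ℝ)

/-- The radius of a ball around the origin that contains the cube, comparable to
the sum of the side length and the distance to the origin. -/
noncomputable def radius (Q : DyadicCube d) : ℝ := ‖Q.corner‖ + d * Q.sideLength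

lemma sideLength_le_radius (hd : 0 < d) (Q : DyadicCube d) : Q.sideLength ≤ Q.radius := by
  have h1 : (1 : ℝ) ≤ d := by exact_mod_cast hd
  have := Q.sideLength_pos
  unfold radius
  nlinarith [norm_nonneg Q.corner]

lemma radius_pos (hd : 0 < d) (Q : DyadicCube d) : 0 < Q.radius :=
  Q.sideLength_pos.trans_le (Q.sideLength_le_radius hd)

lemma norm_sub_corner_le (Q : DyadicCube d) {x : EuclideanSpace ℝ (Fin d)} (hx : x ∈ Q.carrier) :
    ‖x - Q.corner‖ ≤ d * Q.sideLength := by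
  have hl := Q.sideLength_pos
  refine abs_le_of_sq_le_sq' ?_ (by positivity) |>.2
  rw [EuclideanSpace.norm_sq_eq]
  calc ∑ j, ‖(x - Q.corner) j‖ ^ 2 ≤ ∑ _j : Fin d, Q.sideLength ^ 2 := by
        refine Finset.sum_le_sum fun j _ => ?_
        obtain ⟨h1, h2⟩ := hx j
        have h3 : (x - Q.corner) j = x j - Q.sideLength * (Q.m j : ℝ) := rfl
        rw [h3, Real.norm_eq_abs, sq_abs]
        nlinarith
    _ = d * Q.sideLength ^ 2 := by simp
    -- The sharp factor `√d` is relaxed to `d`, which avoids square roots.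
    _ ≤ (d * Q.sideLength) ^ 2 := by
        have : (d : ℝ) ≤ d ^ 2 := by exact_mod_cast Nat.le_self_pow two_ne_zero d
        rw [mul_pow]
        gcongr

lemma norm_le_radius (Q : DyadicCube d) {x : EuclideanSpace ℝ (Fin d)} (hx : x ∈ Q.carrier) :
    ‖x‖ ≤ Q.radius := by
  have h := norm_add_le Q.corner (x - Q.corner)
  rw [add_sub_cancel] at h
  exact h.trans (add_le_add le_rfl (Q.norm_sub_corner_le hx))

lemma volume_carrier (Q : DyadicCube d) :
    volume Q.carrier = ENNReal.ofReal (Q.sideLength ^ d) := by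
  have h : Q.carrier = (MeasurableEquiv.toLp 2 (Fin d → ℝ)).symm ⁻¹' (Set.univ.pi fun j =>
      Set.Ico (Q.sideLength * (Q.m j : ℝ)) (Q.sideLength * ((Q.m j : ℝ) + 1))) := by
    ext x
    simp [carrier]
  rw [h, (EuclideanSpace.volume_preserving_symm_measurableEquiv_toLp (Fin d)).measure_preimage
    (MeasurableSet.univ_pi fun j => measurableSet_Ico).nullMeasurableSet, Real.volume_pi_Ico,
    ENNReal.ofReal_pow Q.sideLength_pos.le]
  simp [mul_add]

lemma measurableSet_carrier (Q : DyadicCube d) : MeasurableSet Q.carrier := by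
  have h : Q.carrier = ⋂ j, {x : EuclideanSpace ℝ (Fin d) | x j ∈
      Set.Ico (Q.sideLength * (Q.m j : ℝ)) (Q.sideLength * ((Q.m j : ℝ) + 1))} := by
    ext x
    simp [carrier]
  rw [h]
  exact MeasurableSet.iInter fun j => measurableSet_Ico.preimage (by fun_prop)

instance : Countable (DyadicCube d) :=
  Function.Injective.countable (f := fun Q : DyadicCube d => (Q.k, Q.m)) fun P Q h => by
    cases P; cases Q; simpa using h

end DyadicCube

/-! ### Averages of weights over cubes -/

lemma weightMass_mono {d : ℕ} {σ τ : EuclideanSpace ℝ (Fin d) → ℝ}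
    {A B : Set (EuclideanSpace ℝ (Fin d))} (hA : A ⊆ B) (h : ∀ x, σ x ≤ τ x) :
    weightMass σ A ≤ weightMass τ B :=
  lintegral_mono' (Measure.restrict_mono hA le_rfl) fun x => ENNReal.ofReal_le_ofReal (h x)

lemma weightMass_le_mul {d : ℕ} {σ : EuclideanSpace ℝ (Fin d) → ℝ}
    {A : Set (EuclideanSpace ℝ (Fin d))} (hA : MeasurableSet A) {c : ℝ} (h : ∀ x ∈ A, σ x ≤ c) :
    weightMass σ A ≤ ENNReal.ofReal c * volume A := by
  rw [← setLIntegral_const]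
  exact setLIntegral_mono' hA fun x hx => ENNReal.ofReal_le_ofReal (h x hx)

/-- The mass of a locally integrable power weight on centred balls. -/
lemma weightMass_powerWeight_closedBall {d : ℕ} (hd : 0 < d) {β : ℝ} (hβ : -(d : ℝ) < β) :
    ∃ C : ℝ, 0 < C ∧ ∀ R : ℝ, 0 < R →
      weightMass (powerWeight β) (Metric.closedBall (0 : EuclideanSpace ℝ (Fin d)) R)
        ≤ ENNReal.ofReal (C * R ^ (β + d)) := by
  have : Nonempty (Fin d) := ⟨⟨0, hd⟩⟩
  have hdim : Module.finrank ℝ (EuclideanSpace ℝ (Fin d)) = d := by simp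
  set v : ℝ := (volume : Measure (EuclideanSpace ℝ (Fin d))).real (Metric.ball 0 1) with hv
  have hv0 : 0 ≤ v := measureReal_nonneg
  -- Polar coordinates give the first term; adding 1 makes positivity immediate from `0 ≤ v`.
  refine ⟨d * v / (β + d) + 1, ?_, fun R hR => ?_⟩
  · have : 0 < β + d := by linarith
    positivity
  have hβd : 0 < β + d := by linarith
  set f : ℝ → ℝ := (Set.Iic R).indicator fun y => y ^ β with hf
  have hpow : ∀ y ∈ Set.Ioi (0 : ℝ), y ^ (d - 1) • f y
      = (Set.Iic R).indicator (fun y => y ^ (β + d - 1)) y := by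
    intro y hy
    by_cases hyR : y ∈ Set.Iic R
    · simp only [hf, Set.indicator_of_mem hyR, smul_eq_mul]
      rw [← Real.rpow_natCast, ← Real.rpow_add hy, Nat.cast_sub hd]
      congr 1
      push_cast
      ring
    · simp [hf, Set.indicator_of_notMem hyR]
  have hint : IntegrableOn (fun y => y ^ (d - 1) • f y) (Set.Ioi (0 : ℝ)) := by
    rw [integrableOn_congr_fun hpow measurableSet_Ioi, integrableOn_indicator_iff measurableSet_Iic,
      Set.inter_comm, Set.Ioi_inter_Iic]
    exact (intervalIntegrable_iff_integrableOn_Ioc_of_le hR.le).1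
      (intervalIntegral.intervalIntegrable_rpow' (by linarith))
  have hI : Integrable (fun x : EuclideanSpace ℝ (Fin d) => f ‖x‖) := by
    rw [integrable_fun_norm_addHaar, hdim]
    exact hint
  have hval : ∫ x : EuclideanSpace ℝ (Fin d), f ‖x‖ = d * v / (β + d) * R ^ (β + d) := by
    rw [integral_fun_norm_addHaar, hdim, setIntegral_congr_fun measurableSet_Ioi hpow,
      setIntegral_indicator measurableSet_Iic, Set.Ioi_inter_Iic,
      ← intervalIntegral.integral_of_le hR.le, integral_rpow (Or.inl (by linarith)),
      sub_add_cancel, Real.zero_rpow hβd.ne']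
    simp only [nsmul_eq_mul, smul_eq_mul, ← hv]
    ring
  have hf0 : ∀ x : EuclideanSpace ℝ (Fin d), 0 ≤ f ‖x‖ := fun x =>
    Set.indicator_apply_nonneg fun _ => Real.rpow_nonneg (norm_nonneg x) β
  calc weightMass (powerWeight β) (Metric.closedBall (0 : EuclideanSpace ℝ (Fin d)) R)
      = ∫⁻ x in Metric.closedBall (0 : EuclideanSpace ℝ (Fin d)) R, ENNReal.ofReal (f ‖x‖) := by
        refine setLIntegral_congr_fun Metric.isClosed_closedBall.measurableSet fun x hx => ?_
        have : ‖x‖ ∈ Set.Iic R := by simpa using hx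
        simp [hf, powerWeight, Set.indicator_of_mem this]
    _ ≤ ∫⁻ x : EuclideanSpace ℝ (Fin d), ENNReal.ofReal (f ‖x‖) := setLIntegral_le_lintegral _ _
    _ = ENNReal.ofReal (∫ x : EuclideanSpace ℝ (Fin d), f ‖x‖) :=
        (ofReal_integral_eq_lintegral_ofReal hI (Filter.Eventually.of_forall hf0)).symm
    _ ≤ _ := by
        rw [hval]
        refine ENNReal.ofReal_le_ofReal ?_
        gcongr
        linarith

/-- The average of a locally integrable power weight over a cube is controlled by the same power
of the radius of the cube. -/
lemma weightMass_powerWeight_le {d : ℕ} (hd : 0 < d) {β : ℝ} (hβ : -(d : ℝ) < β) :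
    ∃ C : ℝ, 0 < C ∧ ∀ Q : DyadicCube d,
      weightMass (powerWeight β) Q.carrier
        ≤ ENNReal.ofReal (C * Q.radius ^ β) * volume Q.carrier := by
  rcases le_or_gt 0 β with h0 | h0
  · refine ⟨1, one_pos, fun Q => weightMass_le_mul Q.measurableSet_carrier fun x hx => ?_⟩
    rw [one_mul]
    exact Real.rpow_le_rpow (norm_nonneg x) (Q.norm_le_radius hx) h0
  obtain ⟨C, hC, hball⟩ := weightMass_powerWeight_closedBall hd hβ
  have hd' : (0 : ℝ) < d := by exact_mod_cast hd
  -- One summand for each case below. Far from the origin, `|x| ≥ R / 3` on the cube. Near it, `R ≤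
  -- 3 d ℓ`, so a centred ball of radius `R` has volume comparable to that of the cube.
  refine ⟨(1 / 3) ^ β + C * (3 * d) ^ d, by positivity, fun Q => ?_⟩
  have hR := Q.radius_pos hd
  have hl := Q.sideLength_pos
  rcases le_or_gt (2 * (d * Q.sideLength)) ‖Q.corner‖ with hfar | hnear
  · refine weightMass_le_mul Q.measurableSet_carrier fun x hx => ?_
    have h1 : 1 / 3 * Q.radius ≤ ‖x‖ := by
      have h2 := norm_sub_norm_le Q.corner x
      rw [norm_sub_rev] at h2
      have h3 := Q.norm_sub_corner_le hx
      unfold DyadicCube.radius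
      linarith
    calc ‖x‖ ^ β ≤ (1 / 3 * Q.radius) ^ β :=
          Real.rpow_le_rpow_of_nonpos (by positivity) h1 h0.le
      _ = (1 / 3) ^ β * Q.radius ^ β := Real.mul_rpow (by norm_num) hR.le
      _ ≤ _ := by
          gcongr
          have : 0 < C * (3 * d : ℝ) ^ d := by positivity
          linarith
  · have h1 : Q.radius ≤ 3 * d * Q.sideLength := by
      unfold DyadicCube.radius
      linarith
    calc weightMass (powerWeight β) Q.carrier
        ≤ weightMass (powerWeight β) (Metric.closedBall 0 Q.radius) :=
          weightMass_mono (fun x hx => by simpa using Q.norm_le_radius hx) fun _ => le_rfl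
      _ ≤ ENNReal.ofReal (C * Q.radius ^ (β + d)) := hball _ hR
      _ ≤ ENNReal.ofReal (((1 / 3) ^ β + C * (3 * d) ^ d) * Q.radius ^ β * Q.sideLength ^ d) := by
          refine ENNReal.ofReal_le_ofReal ?_
          rw [Real.rpow_add hR, Real.rpow_natCast]
          calc C * (Q.radius ^ β * Q.radius ^ d)
              ≤ C * (Q.radius ^ β * (3 * d * Q.sideLength) ^ d) := by gcongr
            _ = C * (3 * d) ^ d * Q.radius ^ β * Q.sideLength ^ d := by
                rw [mul_pow]
                ring
            _ ≤ _ := by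
                gcongr
                have : (0 : ℝ) < (1 / 3) ^ β := by positivity
                linarith
      _ = _ := by
          rw [Q.volume_carrier, ← ENNReal.ofReal_mul (by positivity)]

/-- The average of a damped power weight over a cube is controlled by the value of the weight at
the radius of the cube. -/
lemma weightMass_dampedPowerWeight_le {d : ℕ} (hd : 0 < d) (β : ℝ) {γ : ℝ} (hγ : γ ≤ 0)
    (hβ : -(d : ℝ) < β + γ) : ∃ C : ℝ, 0 < C ∧ ∀ Q : DyadicCube d,
      weightMass (dampedPowerWeight β γ) Q.carrier
        ≤ ENNReal.ofReal (C * (Q.radius ^ β * max Q.radius 1 ^ γ)) * volume Q.carrier := by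
  have : Nonempty (Fin d) := ⟨⟨0, hd⟩⟩
  obtain ⟨C₁, hC₁, h₁⟩ := weightMass_powerWeight_le hd (show -(d : ℝ) < β by linarith)
  obtain ⟨C₂, hC₂, h₂⟩ := weightMass_powerWeight_le hd hβ
  refine ⟨max C₁ C₂, by positivity, fun Q => ?_⟩
  have hR := Q.radius_pos hd
  -- For small cubes the damping factor is bounded by 1; for large ones it is bounded by `|x| ^ γ`
  -- and absorbed into the power.
  rcases le_total Q.radius 1 with hle | hle
  · refine (weightMass_mono subset_rfl fun x => ?_).trans ((h₁ Q).trans ?_)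
    · exact mul_le_of_le_one_right (by positivity)
        (Real.rpow_le_one_of_one_le_of_nonpos (le_max_right _ _) hγ)
    · rw [max_eq_right hle, Real.one_rpow, mul_one]
      gcongr
      exact le_max_left _ _
  · have hae : weightMass (dampedPowerWeight β γ) Q.carrier
        ≤ weightMass (powerWeight (β + γ)) Q.carrier := by
      -- The origin is discarded: adding exponents of `‖x‖` needs a positive base.
      refine lintegral_mono_ae (ae_restrict_of_ae ?_)
      filter_upwards [Measure.ae_ne volume (0 : EuclideanSpace ℝ (Fin d))] with x hx
      refine ENNReal.ofReal_le_ofReal ?_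
      have hx' : 0 < ‖x‖ := norm_pos_iff.2 hx
      unfold dampedPowerWeight powerWeight
      rw [Real.rpow_add hx']
      exact mul_le_mul_of_nonneg_left (Real.rpow_le_rpow_of_nonpos hx' (le_max_left _ _) hγ)
        (by positivity)
    refine hae.trans ((h₂ Q).trans ?_)
    rw [max_eq_left hle, ← Real.rpow_add hR]
    gcongr
    exact le_max_right _ _

/-! ### Products of averages, decay at infinity and scaling -/

/-- A product of averages is controlled by the product of the pointwise bounds. -/
lemma avgProduct_le {d n : ℕ} {σ : Fin n → EuclideanSpace ℝ (Fin d) → ℝ} {p : Fin n → ℝ}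
    (hp : ∀ i, 1 < p i) {f : Fin n → DyadicCube d → ℝ} (hf : ∀ i Q, 0 ≤ f i Q)
    (h : ∀ i, ∃ C : ℝ, 0 < C ∧ ∀ Q : DyadicCube d,
      weightMass (σ i) Q.carrier ≤ ENNReal.ofReal (C * f i Q) * volume Q.carrier) :
    ∃ C : ℝ, 0 < C ∧ ∀ Q : DyadicCube d,
      avgProduct σ p Q ≤ ENNReal.ofReal (C * ∏ i, f i Q ^ (1 / (p i).conjExponent)) := by
  choose C hC hle using h
  have hq : ∀ i, 0 ≤ 1 / (p i).conjExponent := fun i =>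
    one_div_nonneg.2 (Real.HolderConjugate.conjExponent (hp i)).symm.nonneg
  refine ⟨∏ i, C i ^ (1 / (p i).conjExponent),
    Finset.prod_pos fun i _ => Real.rpow_pos_of_pos (hC i) _, fun Q => ?_⟩
  rw [← Finset.prod_mul_distrib, ENNReal.ofReal_prod_of_nonneg fun i _ =>
    mul_nonneg (Real.rpow_nonneg (hC i).le _) (Real.rpow_nonneg (hf i Q) _)]
  refine Finset.prod_le_prod' fun i _ => ?_
  rw [← Real.mul_rpow (hC i).le (hf i Q),
    ← ENNReal.ofReal_rpow_of_nonneg (mul_nonneg (hC i).le (hf i Q)) (hq i)]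
  exact ENNReal.rpow_le_rpow (ENNReal.div_le_of_le_mul (hle i Q)) (hq i)

lemma lintegral_max_norm_one_rpow_lt_top {d : ℕ} {s : ℝ} (hs : s < -(d : ℝ)) :
    ∫⁻ x : EuclideanSpace ℝ (Fin d), ENNReal.ofReal (max ‖x‖ 1 ^ s) < ∞ := by
  have hs0 : s ≤ 0 := hs.le.trans (by simp)
  have hfin := finite_integral_one_add_norm (E := EuclideanSpace ℝ (Fin d)) (μ := volume)
    (r := -s) (by simpa using lt_neg_of_lt_neg hs)
  refine lt_of_le_of_lt (lintegral_mono (g := fun x : EuclideanSpace ℝ (Fin d) =>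
    ENNReal.ofReal ((1 / 2) ^ s) * ENNReal.ofReal ((1 + ‖x‖) ^ (-(-s)))) fun x => ?_) ?_
  · beta_reduce
    rw [← ENNReal.ofReal_mul (by positivity), neg_neg, ← Real.mul_rpow (by norm_num) (by positivity)]
    refine ENNReal.ofReal_le_ofReal (Real.rpow_le_rpow_of_nonpos (by positivity) ?_ hs0)
    linarith [le_max_left ‖x‖ 1, le_max_right ‖x‖ 1]
  · rw [lintegral_const_mul' _ _ ENNReal.ofReal_ne_top]
    exact ENNReal.mul_lt_top ENNReal.ofReal_lt_top hfin

lemma rieszKernel_mul_volume_rpow {d n : ℕ} (α s : ℝ) (Q : DyadicCube d) :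
    ENNReal.ofReal (rieszKernel d n α Q) * volume Q.carrier ^ s
      = ENNReal.ofReal (Q.sideLength ^ (α - ((n : ℝ) - 1) * d + d * s)) := by
  have hl := Q.sideLength_pos
  rw [Q.volume_carrier, ENNReal.ofReal_rpow_of_pos (by positivity), rieszKernel,
    ← ENNReal.ofReal_mul (by positivity), ← Real.rpow_natCast, ← Real.rpow_mul hl.le,
    ← Real.rpow_add hl]

/-- The exponents are opposite, so this is a nonnegative power of `ℓ / R ≤ 1`. Both balance
conditions serve to reach this form. -/
lemma DyadicCube.sideLength_rpow_mul_radius_rpow_le_one {d : ℕ} (hd : 0 < d) (Q : DyadicCube d)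
    {a : ℝ} (ha : 0 ≤ a) : Q.sideLength ^ a * Q.radius ^ (-a) ≤ 1 := by
  have hR := Q.radius_pos hd
  rw [Real.rpow_neg hR.le, ← div_eq_mul_inv]
  exact div_le_one_of_le₀
    (Real.rpow_le_rpow Q.sideLength_pos.le (Q.sideLength_le_radius hd) ha) (by positivity)

/-! ### The two testing constants -/

theorem supConstant_powerWeight_lt_top {d n : ℕ} (hd : 0 < d) (S : Set (DyadicCube d))
    {p : Fin n → ℝ} (hp : ∀ i, 1 < p i) (α : ℝ) {β : Fin n → ℝ} (hβ : ∀ i, -(d : ℝ) < β i)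
    (hbal : α + d * (1 - ∑ i, 1 / p i) + ∑ i, β i / (p i).conjExponent = 0)
    (hle : ∑ i, β i / (p i).conjExponent ≤ 0) :
    supConstant (rieszKernel d n α) S (fun i => powerWeight (β i)) p < ∞ := by
  obtain ⟨C, hC, h⟩ := avgProduct_le (σ := fun i => powerWeight (β i)) hp
    (f := fun i Q => Q.radius ^ β i) (fun i Q => Real.rpow_nonneg (Q.radius_pos hd).le _)
    fun i => weightMass_powerWeight_le hd (hβ i)
  refine lt_of_le_of_lt (iSup₂_le fun Q _ => ?_) (ENNReal.ofReal_lt_top (r := C))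
  have hR := Q.radius_pos hd
  have hl := Q.sideLength_pos
  have hprod : ∏ i, (Q.radius ^ β i) ^ (1 / (p i).conjExponent)
      = Q.radius ^ (-(-∑ i, β i / (p i).conjExponent)) := by
    rw [neg_neg, Real.rpow_sum_of_pos hR]
    refine Finset.prod_congr rfl fun i _ => ?_
    rw [← Real.rpow_mul hR.le, mul_one_div]
  rw [rieszKernel_mul_volume_rpow]
  refine (mul_le_mul_right (h Q) _).trans ?_
  rw [hprod, ← ENNReal.ofReal_mul (by positivity)]
  refine ENNReal.ofReal_le_ofReal ?_
  rw [show α - ((n : ℝ) - 1) * d + d * (n - ∑ i, 1 / p i) = -∑ i, β i / (p i).conjExponent by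
    linear_combination hbal, mul_left_comm]
  exact mul_le_of_le_one_right hC.le
    (Q.sideLength_rpow_mul_radius_rpow_le_one hd (neg_nonneg.2 hle))

/-- Summing the values of a decreasing radial function at the radii of the cubes against disjoint
subsets of the cubes. -/
lemma tsum_max_radius_rpow_mul_volume_lt_top {d : ℕ} {η : ℝ} {S : Set (DyadicCube d)}
    {E : DyadicCube d → Set (EuclideanSpace ℝ (Fin d))} (hS : IsSparseWith η S E)
    {s : ℝ} (hs : s < -(d : ℝ)) :
    ∑' Q : S, ENNReal.ofReal (max (Q : DyadicCube d).radius 1 ^ s) * volume (E Q) < ∞ := by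
  have hs0 : s ≤ 0 := hs.le.trans (by simp)
  calc ∑' Q : S, ENNReal.ofReal (max (Q : DyadicCube d).radius 1 ^ s) * volume (E Q)
      ≤ ∑' Q : S, ∫⁻ x in E Q, ENNReal.ofReal (max ‖x‖ 1 ^ s) := by
        refine ENNReal.tsum_le_tsum fun Q => ?_
        rw [← setLIntegral_const]
        refine setLIntegral_mono' (hS.measurableSet Q Q.2) fun x hx => ENNReal.ofReal_le_ofReal ?_
        -- As `s ≤ 0`, the value at the radius is the smaller one.
        exact Real.rpow_le_rpow_of_nonpos (by positivity)
          (max_le_max (DyadicCube.norm_le_radius _ (hS.subset Q Q.2 hx)) le_rfl) hs0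
    _ = ∫⁻ x in ⋃ Q : S, E Q, ENNReal.ofReal (max ‖x‖ 1 ^ s) := by
        refine (lintegral_iUnion (fun Q : S => hS.measurableSet Q Q.2) ?_ _).symm
        exact fun P Q hPQ => hS.pairwiseDisjoint P.2 Q.2 (Subtype.coe_injective.ne hPQ)
    _ ≤ ∫⁻ x, ENNReal.ofReal (max ‖x‖ 1 ^ s) := setLIntegral_le_lintegral _ _
    _ < ∞ := lintegral_max_norm_one_rpow_lt_top hs

theorem sumConstant_dampedPowerWeight_lt_top {d n : ℕ} (hd : 0 < d) (hn : 0 < n) {η : ℝ}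
    {S : Set (DyadicCube d)} {E : DyadicCube d → Set (EuclideanSpace ℝ (Fin d))}
    (hS : IsSparseWith η S E) {p : Fin n → ℝ} (hp : ∀ i, 1 < p i) {α : ℝ} (hα : 0 < α)
    {β : Fin n → ℝ} {r ρ : ℝ} (hr : 0 < r) (hρ : ρ < -(d : ℝ) / r)
    (hβ : ∀ i, -(d : ℝ) < β i + (p i).conjExponent * ρ / n)
    (hbal : α + ∑ i, β i / (p i).conjExponent = 0) :
    sumConstant (rieszKernel d n α) S E
      (fun i => dampedPowerWeight (β i) ((p i).conjExponent * ρ / n)) p r < ∞ := by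
  have hq : ∀ i, 0 < (p i).conjExponent := fun i =>
    (Real.HolderConjugate.conjExponent (hp i)).symm.pos
  have hρ0 : ρ ≤ 0 := hρ.le.trans (div_nonpos_of_nonpos_of_nonneg (by simp) hr.le)
  have hn0 : (n : ℝ) ≠ 0 := by exact_mod_cast hn.ne'
  obtain ⟨C, hC, h⟩ := avgProduct_le
    (σ := fun i => dampedPowerWeight (β i) ((p i).conjExponent * ρ / n)) hp
    (f := fun i Q => Q.radius ^ β i * max Q.radius 1 ^ ((p i).conjExponent * ρ / n))
    (fun i Q => mul_nonneg (Real.rpow_nonneg (Q.radius_pos hd).le _)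
      (Real.rpow_nonneg (by positivity) _))
    fun i => weightMass_dampedPowerWeight_le hd (β i) (div_nonpos_of_nonpos_of_nonneg
      (mul_nonpos_of_nonneg_of_nonpos (hq i).le hρ0) (Nat.cast_nonneg n)) (hβ i)
  have hterm : ∀ Q : DyadicCube d,
      ENNReal.ofReal (rieszKernel d n α Q) * volume Q.carrier ^ ((n : ℝ) - 1)
        * avgProduct (fun i => dampedPowerWeight (β i) ((p i).conjExponent * ρ / n)) p Q
      ≤ ENNReal.ofReal (C * max Q.radius 1 ^ ρ) := by
    intro Q
    have hR := Q.radius_pos hd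
    have hl := Q.sideLength_pos
    have hM : 0 < max Q.radius 1 := by positivity
    have hprod : ∏ i, (Q.radius ^ β i * max Q.radius 1 ^ ((p i).conjExponent * ρ / n))
        ^ (1 / (p i).conjExponent) = Q.radius ^ (-α) * max Q.radius 1 ^ ρ := by
      -- Each weight contributes an equal share `ρ / n` of the damping once raised to the power `1 /
      -- p_i'`.
      have hρsum : ρ = ∑ _i : Fin n, ρ / n := by
        simp [mul_div_cancel₀ ρ hn0]
      rw [show -α = ∑ i, β i / (p i).conjExponent by linear_combination -hbal,
        Real.rpow_sum_of_pos hR]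
      conv_rhs => rw [hρsum, Real.rpow_sum_of_pos hM]
      rw [← Finset.prod_mul_distrib]
      refine Finset.prod_congr rfl fun i _ => ?_
      rw [Real.mul_rpow (by positivity) (by positivity), ← Real.rpow_mul hR.le,
        ← Real.rpow_mul hM.le, mul_one_div]
      congr 2
      have := (hq i).ne'
      field_simp
    rw [rieszKernel_mul_volume_rpow]
    refine (mul_le_mul_right (h Q) _).trans ?_
    rw [hprod, ← ENNReal.ofReal_mul (by positivity)]
    refine ENNReal.ofReal_le_ofReal ?_
    rw [show α - ((n : ℝ) - 1) * d + d * ((n : ℝ) - 1) = α by ring]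
    calc Q.sideLength ^ α * (C * (Q.radius ^ (-α) * max Q.radius 1 ^ ρ))
        = (Q.sideLength ^ α * Q.radius ^ (-α)) * (C * max Q.radius 1 ^ ρ) := by ring
      _ ≤ _ := mul_le_of_le_one_left (by positivity)
        (Q.sideLength_rpow_mul_radius_rpow_le_one hd hα.le)
  refine ENNReal.rpow_lt_top_of_nonneg (one_div_nonneg.2 hr.le) (ne_of_lt ?_)
  refine lt_of_le_of_lt (ENNReal.tsum_le_tsum (g := fun Q : S => ENNReal.ofReal (C ^ r) *
    (ENNReal.ofReal (max (Q : DyadicCube d).radius 1 ^ (ρ * r)) * volume (E Q))) fun Q => ?_) ?_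
  · have hM : 0 < max (Q : DyadicCube d).radius 1 := by positivity
    rw [← mul_assoc, ← ENNReal.ofReal_mul (by positivity), Real.rpow_mul hM.le,
      ← Real.mul_rpow hC.le (by positivity), ← ENNReal.ofReal_rpow_of_pos (by positivity)]
    exact mul_le_mul_left (ENNReal.rpow_le_rpow (hterm Q) hr.le) _
  · rw [ENNReal.tsum_mul_left]
    exact ENNReal.mul_lt_top ENNReal.ofReal_lt_top
      (tsum_max_radius_rpow_mul_volume_lt_top hS ((lt_div_iff₀ hr).1 hρ))

theorem mainTheorem3 {d n : ℕ} (hn : 2 ≤ n)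
    {η : ℝ} (hη₀ : 0 < η) (hη₁ : η < 1)
    (S : Set (DyadicCube d)) (E : DyadicCube d → Set (EuclideanSpace ℝ (Fin d)))
    (hS : IsSparseWith η S E)
    (p : Fin n → ℝ) (hp : ∀ i, 1 < p i)
    (α : ℝ) (hα₀ : 0 < α) (hα₁ : α < ((n : ℝ) - 1) * d)
    (β : Fin n → ℝ) :
    (1 ≤ ∑ i, 1 / p i →
      (∀ i, -(d : ℝ) < β i) →
      α + d * (1 - ∑ i, 1 / p i) + ∑ i, β i / (p i).conjExponent = 0 →
      ∑ i, β i / (p i).conjExponent ≤ 0 →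
      supConstant (rieszKernel d n α) S (fun i => powerWeight (β i)) p < ∞) ∧
    (∑ i, 1 / p i < 1 →
      ∀ r ρ : ℝ, 1 / r + ∑ i, 1 / p i = 1 →
      ρ < -(d : ℝ) / r →
      (∀ i, -(d : ℝ) < β i + (p i).conjExponent * ρ / n) →
      α + ∑ i, β i / (p i).conjExponent = 0 →
      sumConstant (rieszKernel d n α) S E
        (fun i => dampedPowerWeight (β i) ((p i).conjExponent * ρ / n)) p r < ∞) := by
  -- In dimension zero the bounds on `α` would read `0 < α < 0`.
  have hd : 0 < d := by
    rcases Nat.eq_zero_or_pos d with rfl | hd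
    · simp only [Nat.cast_zero, mul_zero] at hα₁
      exact absurd hα₁ hα₀.not_gt
    · exact hd
  refine ⟨fun _ hβ hbal hle => supConstant_powerWeight_lt_top hd S hp α hβ hbal hle,
    fun hsum r ρ hr hρ hβ hbal => ?_⟩
  exact sumConstant_dampedPowerWeight_lt_top hd (by omega) hS hp hα₀
    (one_div_pos.1 (by linarith)) hρ hβ hbal
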